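/- Let $\mathcal{B}$ be a unital $C^*$-algebra. For a set $K$ let $\mathcal{B}\langle x_k; k\in K\rangle$ be the $*$-algebra of non-commutative polynomials in the formal variables $x_k=x_k^*$ with coefficients from $\mathcal{B}$, i.e., the free product of $\mathcal{B}$ and $\mathbb{C}\langle x_k;k\in K\rangle$ with amalgamation over $\mathbb{C}\cdot 1$. Let $\Sigma_{\mathcal{B}}^{K,0}$ be the set of all linear maps $\mu:\mathcal{B}\langle x_k;k\in K\rangle\to\mathcal{B}$ such that (i) $\mu(1)=1$; (ii) $\mu(b\,p\,b')=b\,\mu(p)\,b'$ for all $b,b'\in\mathcal{B}$ and all $p\in\mathcal{B}\langle x_k;k\in K\rangle$; (iii) $(\mathrm{id}\otimes\mu)(p^*p)\geq 0$ in $M_n(\mathcal{B})$ for all $n\in\mathbb{N}$ and all $p\in M_n(\mathcal{B}\langle x_k;k\in K\rangle)$; (iv) there is $M>0$ such that $\|\mu(x_{k_1}b_1x_{k_2}b_2\cdots b_{m-1}x_{k_m})\|\leq M^m\|b_1\|\cdots\|b_{m-1}\|$ for all $m\geq 1$, $k_1,\dots,k_m\in K$ and $b_1,\dots,b_{m-1}\in\mathcal{B}$.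 Let $I$ and $J$ be disjoint sets, and let $\mu_I\in\Sigma_{\mathcal{B}}^{I,0}$ on $\mathcal{B}\langle x_i;i\in I\rangle$ and $\mu_J\in\Sigma_{\mathcal{B}}^{J,0}$ on $\mathcal{B}\langle y_j;j\in J\rangle$. Then there exists a uniquely determined $\mu\in\Sigma_{\mathcal{B}}^{I\cup J,0}$ on $\mathcal{B}\langle x_i,y_j;i\in I,j\in J\rangle$ such that: - the restriction of $\mu$ to $\mathcal{B}\langle x_i;i\in I\rangle$ is $\mu_I$, and the restriction of $\mu$ to $\mathcal{B}\langle y_j;j\in J\rangle$ is $\mu_J$; - the subalgebras $\mathcal{A}_1=\mathcal{B}\langle x_i;i\in I\rangle$ and $\mathcal{A}_2=\mathcal{B}\langle y_j;j\in J\rangle$ are free with respect to $\mu$, i.e., $\mu(a_1\cdots a_k)=0$ whenever $k\geq 1$, $a_l\in\mathcal{A}_{t_l}$ with $t_l\in\{1,2\}$ and $\mu(a_l)=0$ for $l=1,\dots,k$, and $t_1\neq t_2\neq\cdots\neq t_k$. This $\mu$ is denoted by $\mu_I*\mu_J$. -/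

import Mathlib

universe u v w

noncomputable section

/-- The defining relations of the free product (over `ℂ`) of the algebra `B` with the free algebra on
the variables `i : I`: the generators coming from `B` are multiplied, added and scaled as in `B`. -/
inductive NCPolyRel (B : Type u) [Ring B] [Algebra ℂ B] (I : Type v) :
    FreeAlgebra ℂ (B ⊕ I) → FreeAlgebra ℂ (B ⊕ I) → Prop
  | add (a b : B) : NCPolyRel B I (FreeAlgebra.ι ℂ (Sum.inl (a + b)))
      (FreeAlgebra.ι ℂ (Sum.inl a) + FreeAlgebra.ι ℂ (Sum.inl b))
  | mul (a b : B) : NCPolyRel B I (FreeAlgebra.ι ℂ (Sum.inl (a * b)))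
      (FreeAlgebra.ι ℂ (Sum.inl a) * FreeAlgebra.ι ℂ (Sum.inl b))
  | scalar (c : ℂ) : NCPolyRel B I (FreeAlgebra.ι ℂ (Sum.inl (algebraMap ℂ B c)))
      (algebraMap ℂ (FreeAlgebra ℂ (B ⊕ I)) c)

/-- `B⟨x_i; i ∈ I⟩`: non-commutative polynomials in the formal variables `x_i`, `i : I`, with
coefficients from `B` (which do not commute with the variables), i.e. the free product of `B` and
`ℂ⟨x_i; i ∈ I⟩` with amalgamation over `ℂ · 1`. -/
def NCPoly (B : Type u) [Ring B] [Algebra ℂ B] (I : Type v) : Type (max u v) :=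
  RingQuot (NCPolyRel B I)

namespace NCPoly

section Algebra

variable {B : Type u} [Ring B] [Algebra ℂ B] {I : Type v}

instance : Ring (NCPoly B I) := inferInstanceAs (Ring (RingQuot (NCPolyRel B I)))

instance : Algebra ℂ (NCPoly B I) := inferInstanceAs (Algebra ℂ (RingQuot (NCPolyRel B I)))

/-- The quotient map from the free algebra. -/
def mk (B : Type u) [Ring B] [Algebra ℂ B] (I : Type v) :
    FreeAlgebra ℂ (B ⊕ I) →ₐ[ℂ] NCPoly B I :=
  RingQuot.mkAlgHom ℂ (NCPolyRel B I)

theorem mk_rel {p q : FreeAlgebra ℂ (B ⊕ I)} (h : NCPolyRel B I p q) : mk B I p = mk B I q :=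
  RingQuot.mkAlgHom_rel ℂ h

/-- The constant polynomials: the canonical homomorphism `B → B⟨x_i; i ∈ I⟩`. -/
def C (I : Type v) : B →ₐ[ℂ] NCPoly B I where
  toFun b := mk B I (FreeAlgebra.ι ℂ (Sum.inl b))
  map_one' := by
    have h := mk_rel (NCPolyRel.scalar (B := B) (I := I) 1)
    simpa using h
  map_mul' a b := by simpa using mk_rel (NCPolyRel.mul (I := I) a b)
  map_zero' := by
    have h := mk_rel (NCPolyRel.scalar (B := B) (I := I) 0)
    simpa using h
  map_add' a b := by simpa using mk_rel (NCPolyRel.add (I := I) a b)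
  commutes' c := by
    have h := mk_rel (NCPolyRel.scalar (B := B) (I := I) c)
    simpa using h

/-- The variable `x_i`. -/
def X (B : Type u) [Ring B] [Algebra ℂ B] {I : Type v} (i : I) : NCPoly B I :=
  mk B I (FreeAlgebra.ι ℂ (Sum.inr i))

/-- The universal property of `B⟨x_i; i ∈ I⟩`: a homomorphism is given by a homomorphism on `B`
and arbitrary images of the variables. -/
def lift {A : Type w} [Ring A] [Algebra ℂ A] (f : B →ₐ[ℂ] A) (x : I → A) :
    NCPoly B I →ₐ[ℂ] A :=
  RingQuot.liftAlgHom ℂ ⟨FreeAlgebra.lift ℂ (Sum.elim f x), by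
    intro p q h
    cases h <;> simp⟩

@[simp]
theorem lift_C {A : Type w} [Ring A] [Algebra ℂ A] (f : B →ₐ[ℂ] A) (x : I → A) (b : B) :
    lift f x (C I b) = f b := by
  change RingQuot.liftAlgHom ℂ _ (RingQuot.mkAlgHom ℂ _ _) = _
  rw [RingQuot.liftAlgHom_mkAlgHom_apply]
  simp

@[simp]
theorem lift_X {A : Type w} [Ring A] [Algebra ℂ A] (f : B →ₐ[ℂ] A) (x : I → A) (i : I) :
    lift f x (X B i) = x i := by
  change RingQuot.liftAlgHom ℂ _ (RingQuot.mkAlgHom ℂ _ _) = _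
  rw [RingQuot.liftAlgHom_mkAlgHom_apply]
  simp

@[elab_as_elim]
theorem induction {P : NCPoly B I → Prop} (hC : ∀ b, P (C I b)) (hX : ∀ i, P (X B i))
    (hadd : ∀ p q, P p → P q → P (p + q)) (hmul : ∀ p q, P p → P q → P (p * q))
    (p : NCPoly B I) : P p := by
  obtain ⟨a, rfl⟩ := RingQuot.mkAlgHom_surjective ℂ (NCPolyRel B I) p
  change P (mk B I a)
  induction a using FreeAlgebra.induction with
  | grade0 c =>
    have h := hC (algebraMap ℂ B c)
    rwa [AlgHom.commutes, ← AlgHom.commutes (mk B I)] at h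
  | grade1 s =>
    cases s with
    | inl b => exact hC b
    | inr i => exact hX i
  | mul a b ha hb => rw [map_mul]; exact hmul _ _ ha hb
  | add a b ha hb => rw [map_add]; exact hadd _ _ ha hb

/-- The map `B⟨x_i; i ∈ I⟩ → B⟨x_k; k ∈ K⟩` with `x_i ↦ x_{f i}`. For injective `f` it is
the inclusion of the polynomials that use only the variables with index in the range of `f`. -/
def rename {K : Type w} (f : I → K) : NCPoly B I →ₐ[ℂ] NCPoly B K :=
  lift (C K) (fun i => X B (f i))

end Algebra

section Star

/-- The opposite algebra with complex conjugated scalars. -/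
def ConjOpp (A : Type w) : Type w := Aᵐᵒᵖ

instance {A : Type w} [Ring A] : Ring (ConjOpp A) := inferInstanceAs (Ring Aᵐᵒᵖ)

instance {A : Type w} [Ring A] [Algebra ℂ A] : Algebra ℂ (ConjOpp A) :=
  RingHom.toAlgebra' (((algebraMap ℂ Aᵐᵒᵖ).comp (starRingEnd ℂ) : ℂ →+* Aᵐᵒᵖ))
    (fun c x => Algebra.commutes (A := Aᵐᵒᵖ) (starRingEnd ℂ c) x)

variable {B : Type u} [Ring B] [StarRing B] [Algebra ℂ B] [StarModule ℂ B] {I : Type v}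

/-- The identity map from `A` to its conjugate opposite algebra. -/
def toConjOpp {A : Type w} (a : A) : ConjOpp A := MulOpposite.op a

/-- The identity map from the conjugate opposite algebra to `A`. -/
def ofConjOpp {A : Type w} (a : ConjOpp A) : A := MulOpposite.unop a

/-- The involution as a homomorphism to the conjugate opposite algebra. -/
def starHom (B : Type u) [Ring B] [StarRing B] [Algebra ℂ B] [StarModule ℂ B] (I : Type v) :
    NCPoly B I →ₐ[ℂ] ConjOpp (NCPoly B I) :=
  lift
    { toFun := fun b => toConjOpp (C I (star b))
      map_one' := by rw [star_one, map_one]; rfl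
      map_mul' := fun a b => by rw [star_mul, map_mul]; rfl
      map_zero' := by rw [star_zero, map_zero]; rfl
      map_add' := fun a b => by rw [star_add, map_add]; rfl
      commutes' := fun c => by
        change toConjOpp _ = toConjOpp (algebraMap ℂ (NCPoly B I) (starRingEnd ℂ c))
        rw [← algebraMap_star_comm, AlgHom.commutes]
        rfl }
    (fun i => toConjOpp (X B i))

/-- The involution of `B⟨x_i; i ∈ I⟩`: antimultiplicative, conjugate linear, extending that of `B`,
with `x_i* = x_i`. -/
instance : Star (NCPoly B I) :=
  ⟨fun p => ofConjOpp (starHom B I p)⟩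

theorem star_mul_aux (p q : NCPoly B I) : star (p * q) = star q * star p := by
  change ofConjOpp (starHom B I (p * q)) = _
  rw [map_mul]
  rfl

theorem star_add_aux (p q : NCPoly B I) : star (p + q) = star p + star q := by
  change ofConjOpp (starHom B I (p + q)) = _
  rw [map_add]
  rfl

@[simp]
theorem star_C (b : B) : star (C I b) = C I (star b) := by
  change ofConjOpp (starHom B I (C I b)) = _
  rw [starHom, lift_C]
  rfl

@[simp]
theorem star_X (i : I) : star (X B i) = X B i := by
  change ofConjOpp (starHom B I (X B i)) = _
  rw [starHom, lift_X]
  rfl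

instance : StarRing (NCPoly B I) where
  star_involutive p := by
    induction p using NCPoly.induction with
    | hC b => simp
    | hX i => simp
    | hadd p q hp hq => rw [star_add_aux, star_add_aux, hp, hq]
    | hmul p q hp hq => rw [star_mul_aux, star_mul_aux, hp, hq]
  star_mul := star_mul_aux
  star_add := star_add_aux

instance : StarModule ℂ (NCPoly B I) where
  star_smul c p := by
    rw [Algebra.smul_def, star_mul, ← AlgHom.commutes (C (B := B) I) c, star_C,
      ← algebraMap_star_comm, AlgHom.commutes, ← Algebra.commutes, ← Algebra.smul_def]

end Star

end NCPoly

open NCPoly in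
/-- `μ` is a `B`-valued joint distribution on `B⟨x_i; i ∈ I⟩`, i.e. an element of `Σ_B^{I,0}`:
a unital, completely positive and exponentially bounded `B`-`B`-bimodule map. -/
structure IsJointDistribution {B : Type u} [CStarAlgebra B] {I : Type v}
    (μ : NCPoly B I →ₗ[ℂ] B) : Prop where
  /-- `μ` is unital. -/
  map_one : μ 1 = 1
  /-- `μ` is a `B`-`B`-bimodule map. -/
  map_bimodule : ∀ (b : B) (p : NCPoly B I) (b' : B), μ (C I b * p * C I b') = b * μ p * b'
  /-- `μ` is completely positive: for every `p ∈ M_n(B⟨x_i; i ∈ I⟩)` the matrix `(id ⊗ μ)(p* p)` is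
  positive in the C*-algebra `M_n(B)`, that is, of the form `c* c` with `c ∈ M_n(B)`. -/
  completelyPositive : ∀ (n : ℕ) (p : Matrix (Fin n) (Fin n) (NCPoly B I)),
    ∃ c : Matrix (Fin n) (Fin n) B, (p.conjTranspose * p).map μ = c.conjTranspose * c
  /-- `μ` is exponentially bounded: `‖μ(x_{i₀} b₁ x_{i₁} ⋯ b_k x_{i_k})‖ ≤ M^(k+1) ‖b₁‖ ⋯ ‖b_k‖`,
  where `l` lists the pairs `(b₁, i₁), …, (b_k, i_k)`. (The bound `‖μ(1)‖ ≤ M ^ 0` for the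
  empty monomial is automatic.) -/
  exponentiallyBounded : ∃ M : ℝ, 0 < M ∧ ∀ (i : I) (l : List (B × I)),
    ‖μ (X B i * (l.map fun s => C I s.1 * X B s.2).prod)‖
      ≤ M ^ (l.length + 1) * (l.map fun s => ‖s.1‖).prod

/-- Freeness with respect to `E : A → B` of a family of subalgebras `S t ⊆ A` (each containing the
copy of `B` in `A`): `E(a₁ ⋯ a_k) = 0` whenever `k ≥ 1`, `a_j ∈ S t_j`, `E(a_j) = 0` for all `j`, and
`t₁ ≠ t₂ ≠ ⋯ ≠ t_k`. The list `l` consists of the pairs `(t_j, a_j)`. -/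
def IsFreeOver {A : Type u} [Ring A] [Algebra ℂ A] {B : Type v} [Ring B] [Algebra ℂ B]
    {T : Type w} (E : A →ₗ[ℂ] B) (S : T → Subalgebra ℂ A) : Prop :=
  ∀ l : List (T × A), l ≠ [] → (∀ s ∈ l, s.2 ∈ S s.1 ∧ E s.2 = 0) →
    l.IsChain (fun s t => s.1 ≠ t.1) → E (l.map fun s => s.2).prod = 0

end

/-! Existence is proved with an algebraic model of the free product of Fock spaces. For a single
factor, the bijection `encode`, `a ↦ a - ε(a) + μ(a)`, with ε the augmentation killing all
variables, carries ker μ onto ker ε. An alternating product of polynomials without constant term in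
`B⟨x_i, y_j⟩` can therefore stand for the alternating product of the corresponding centred elements,
so the polynomial algebra itself serves as the representation space. Each factor acts by splitting
off the initial block in its own variables, decoding it, multiplying on the left and encoding again
(`act`). This is multiplicative (`act_mul`), so the two actions combine into `freeRep`, and μ(p) is
the augmentation of p applied to 1. A centred alternating word sends 1 to the product of its encoded
letters (`freeRep_alternating`). The multiplicative ε kills that product, which is freeness.

Positivity uses only freeness and positivity on the factors. In μ(v* a w), with v and w reduced
words not starting in the factor of a, the middle a may be replaced by μ(a) (`map_star_mul_mul`).
Gram kernels of words thus reduce to Gram kernels of shorter words (`gram_mul_mem_posKernel`), and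
words span (`mem_closure_reducedWord`). The same spanning yields uniqueness (`eq_of_free`): freeness
fixes the value on every reduced word.

For the exponential bound, weigh a monomial of degree n by Rⁿ times the norms of its coefficients.
Encoding and decoding each at most triple the weight, so a variable acts with factor 9R
(`PolyBound.act_X`), and ε is contractive for the weight. -/

noncomputable section

/-! ### Positive kernels with values in a C*-algebra -/

section PosKernel

variable {B : Type u}

/-- The cone of `B`-valued kernels that are finite sums of rank one kernels `c i* c j`. -/
def posKernel (ι : Type*) (B : Type u) [NonUnitalRing B] [StarRing B] :
    AddSubmonoid (Matrix ι ι B) :=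
  AddSubmonoid.closure (Set.range fun c : ι → B => Matrix.of fun i j => star (c i) * c j)

theorem rankOne_mem_posKernel [NonUnitalRing B] [StarRing B] {ι : Type*} (c : ι → B) :
    (Matrix.of fun i j => star (c i) * c j) ∈ posKernel ι B :=
  AddSubmonoid.subset_closure ⟨c, rfl⟩

theorem posKernel_isHermitian [NonUnitalRing B] [StarRing B] {ι : Type*} {G : Matrix ι ι B}
    (hG : G ∈ posKernel ι B) (i j : ι) : star (G i j) = G j i := by
  induction hG using AddSubmonoid.closure_induction with
  | mem G h => obtain ⟨c, rfl⟩ := h; simp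
  | zero => simp
  | add G H _ _ hG hH => simp [hG, hH]

theorem submatrix_mem_posKernel [NonUnitalRing B] [StarRing B] {ι κ : Type*} {G : Matrix ι ι B}
    (hG : G ∈ posKernel ι B) (f : κ → ι) : G.submatrix f f ∈ posKernel κ B := by
  induction hG using AddSubmonoid.closure_induction with
  | mem G h => obtain ⟨c, rfl⟩ := h; exact rankOne_mem_posKernel (c ∘ f)
  | zero => exact zero_mem _
  | add G H _ _ hG hH => exact add_mem hG hH

/-- Summing the vector c over blocks turns a rank one kernel into a rank one kernel. This passes
from Gram kernels of words to those of sums of words. -/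
theorem blockSum_mem_posKernel [NonUnitalRing B] [StarRing B] {ι : Type*} {α : ι → Type*}
    [∀ i, Fintype (α i)] {G : Matrix (Σ i, α i) (Σ i, α i) B}
    (hG : G ∈ posKernel (Σ i, α i) B) :
    (Matrix.of fun i j => ∑ k : α i, ∑ l : α j, G ⟨i, k⟩ ⟨j, l⟩) ∈ posKernel ι B := by
  induction hG using AddSubmonoid.closure_induction with
  | mem G h =>
    obtain ⟨c, rfl⟩ := h
    convert rankOne_mem_posKernel (fun i => ∑ k : α i, c ⟨i, k⟩) using 1
    ext i j
    simp [star_sum, Finset.sum_mul_sum]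
  | zero => convert zero_mem (posKernel ι B) using 1; ext i j; simp
  | add G H _ _ hG hH =>
    convert add_mem hG hH using 1
    ext i j
    simp [Finset.sum_add_distrib]

theorem conjTranspose_mul_self_mem_posKernel [NonUnitalRing B] [StarRing B] {ι κ : Type*}
    [Fintype κ] (c : Matrix κ ι B) : c.conjTranspose * c ∈ posKernel ι B := by
  have h : c.conjTranspose * c = ∑ r, Matrix.of fun i j => star (c r i) * c r j := by
    ext i j
    simp [Matrix.mul_apply, Matrix.sum_apply]
  rw [h]
  exact sum_mem fun r _ => rankOne_mem_posKernel (c r)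

theorem CStarAlgebra.exists_eq_star_mul_self {A : Type*} [CStarAlgebra A] [PartialOrder A]
    [StarOrderedRing A] {a : A} (ha : 0 ≤ a) : ∃ c : A, a = star c * c :=
  CStarAlgebra.nonneg_iff_eq_star_mul_self.mp ha

/-- A rank one kernel is A* A for the matrix A with first row c and zeros elsewhere. Positive
elements of the C*-algebra M_n(B) are closed under sums, and each of them is again of the form c* c.
-/
theorem exists_eq_conjTranspose_mul_self_of_mem_posKernel [CStarAlgebra B] {n : ℕ}
    {G : Matrix (Fin n) (Fin n) B} (hG : G ∈ posKernel (Fin n) B) :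
    ∃ c : Matrix (Fin n) (Fin n) B, G = c.conjTranspose * c := by
  let _ := CStarAlgebra.spectralOrder B
  have := CStarAlgebra.spectralOrderedRing B
  suffices h : 0 ≤ CStarMatrix.ofMatrix G by
    obtain ⟨c, hc⟩ := CStarAlgebra.exists_eq_star_mul_self h
    exact ⟨CStarMatrix.ofMatrix.symm c, hc⟩
  induction hG using AddSubmonoid.closure_induction with
  | mem G h =>
    obtain ⟨c, rfl⟩ := h
    cases n with
    | zero => exact le_of_eq (by ext i; exact i.elim0)
    | succ n =>
      have key : CStarMatrix.ofMatrix (Matrix.of fun i j => star (c i) * c j) =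
          star (CStarMatrix.ofMatrix (Matrix.of fun (i j : Fin (n + 1)) =>
            if i = 0 then c j else 0)) *
          CStarMatrix.ofMatrix (Matrix.of fun (i j : Fin (n + 1)) => if i = 0 then c j else 0) := by
        ext i j
        simp [CStarMatrix.mul_apply, CStarMatrix.star_apply]
      rw [key]
      exact star_mul_self_nonneg _
  | zero => exact le_rfl
  | add G H _ _ hG hH => exact add_nonneg hG hH

/-- The Gram kernel of a family of elements with respect to a `B`-valued map. -/
def gram {P : Type*} [Mul P] [Star P] {ι : Type*} (μ : P → B) (a : ι → P) : Matrix ι ι B :=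
  Matrix.of fun i j => μ (star (a i) * a j)

end PosKernel

namespace IsJointDistribution

variable {B : Type u} [CStarAlgebra B] {I : Type v} {μ : NCPoly B I →ₗ[ℂ] B}

/-- Complete positivity is applied to the square matrix with the family as its first row and zeros
elsewhere. -/
theorem gram_mem_posKernel (hμ : IsJointDistribution μ) {ι : Type*} [Finite ι]
    (a : ι → NCPoly B I) : gram μ a ∈ posKernel ι B := by
  obtain ⟨n, ⟨e⟩⟩ := Finite.exists_equiv_fin ι
  suffices h : gram μ (a ∘ e.symm) ∈ posKernel (Fin n) B by
    convert submatrix_mem_posKernel h e using 1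
    ext i j
    simp [gram]
  cases n with
  | zero =>
    convert zero_mem (posKernel (Fin 0) B)
    ext i
    exact i.elim0
  | succ n =>
    obtain ⟨c, hc⟩ := hμ.completelyPositive (n + 1)
      (Matrix.of fun (i j : Fin (n + 1)) => if i = 0 then a (e.symm j) else 0)
    convert conjTranspose_mul_self_mem_posKernel c using 1
    rw [← hc]
    ext i j
    simp [gram, Matrix.mul_apply]

theorem map_C_mul (hμ : IsJointDistribution μ) (b : B) (p : NCPoly B I) :
    μ (NCPoly.C I b * p) = b * μ p := by
  simpa using hμ.map_bimodule b p 1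

theorem map_mul_C (hμ : IsJointDistribution μ) (p : NCPoly B I) (b : B) :
    μ (p * NCPoly.C I b) = μ p * b := by
  simpa using hμ.map_bimodule 1 p b

theorem map_C (hμ : IsJointDistribution μ) (b : B) : μ (NCPoly.C I b) = b := by
  simpa [hμ.map_one] using hμ.map_C_mul b 1

end IsJointDistribution


/-! ### Positivity and uniqueness of `B`-valued maps with free subalgebras -/

section Free

variable {B : Type u} [CStarAlgebra B] {K : Type v}

/-- A unital `B`-`B`-bimodule map for which the subalgebras `S 0` and `S 1`, which contain `B` and
the variables, are free, and which is completely positive on each of them. -/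
structure IsFreePair (μ : NCPoly B K →ₗ[ℂ] B) (S : Fin 2 → Subalgebra ℂ (NCPoly B K)) :
    Prop where
  map_one : μ 1 = 1
  map_bimodule : ∀ (b : B) (p : NCPoly B K) (b' : B),
    μ (NCPoly.C K b * p * NCPoly.C K b') = b * μ p * b'
  C_mem : ∀ t b, NCPoly.C K b ∈ S t
  star_mem : ∀ t, ∀ a ∈ S t, star a ∈ S t
  X_mem : ∀ k, ∃ t, NCPoly.X B k ∈ S t
  gram_mem : ∀ t (ι : Type) [Finite ι] (a : ι → NCPoly B K), (∀ i, a i ∈ S t) →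
    gram μ a ∈ posKernel ι B
  free : IsFreeOver μ S

/-- Products `a₁ ⋯ a_m b` with `m ≤ n`, `b : B`, and centred `a_j ∈ S t_j` such that
`t ≠ t₁ ≠ ⋯ ≠ t_m`. -/
inductive ReducedWord (μ : NCPoly B K →ₗ[ℂ] B) (S : Fin 2 → Subalgebra ℂ (NCPoly B K)) :
    Fin 2 → ℕ → NCPoly B K → Prop
  | const (t : Fin 2) (n : ℕ) (b : B) : ReducedWord μ S t n (NCPoly.C K b)
  | cons {t s : Fin 2} {n : ℕ} {a w : NCPoly B K} (hts : t ≠ s) (ha : a ∈ S s) (ha0 : μ a = 0)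
      (hw : ReducedWord μ S s n w) : ReducedWord μ S t (n + 1) (a * w)

theorem ReducedWord.mono {μ : NCPoly B K →ₗ[ℂ] B} {S : Fin 2 → Subalgebra ℂ (NCPoly B K)}
    {t : Fin 2} {n m : ℕ} {w : NCPoly B K} (hw : ReducedWord μ S t n w) (h : n ≤ m) :
    ReducedWord μ S t m w := by
  induction hw generalizing m with
  | const t n b => exact .const t m b
  | cons hts ha ha0 _ ih =>
    obtain ⟨m, rfl⟩ : ∃ k, m = k + 1 := ⟨m - 1, by omega⟩
    exact .cons hts ha ha0 (ih (by omega))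

/-- The dummy head `(t, d)` records that the first letter, if any, does not come from `S t`; its
entry `d` plays no role. -/
theorem ReducedWord.exists_list {μ : NCPoly B K →ₗ[ℂ] B}
    {S : Fin 2 → Subalgebra ℂ (NCPoly B K)} {t : Fin 2} {n : ℕ} {w : NCPoly B K}
    (hw : ReducedWord μ S t n w) : ∃ (l : List (Fin 2 × NCPoly B K)) (b : B),
      w = (l.map fun s => s.2).prod * NCPoly.C K b ∧ (∀ s ∈ l, s.2 ∈ S s.1 ∧ μ s.2 = 0) ∧
      ∀ d, ((t, d) :: l).IsChain (fun s t => s.1 ≠ t.1) := by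
  induction hw with
  | const t n b => exact ⟨[], b, by simp, by simp, by simp⟩
  | @cons t s n a w hts ha ha0 _ ih =>
    obtain ⟨l, b, rfl, hl, hc⟩ := ih
    refine ⟨(s, a) :: l, b, by simp [mul_assoc], ?_, fun d => ?_⟩
    · simpa [ha, ha0] using hl
    · exact List.isChain_cons_cons.mpr ⟨hts, hc a⟩

namespace IsFreePair

variable {μ : NCPoly B K →ₗ[ℂ] B} {S : Fin 2 → Subalgebra ℂ (NCPoly B K)}

theorem map_C_mul (h : IsFreePair μ S) (b : B) (p : NCPoly B K) :
    μ (NCPoly.C K b * p) = b * μ p := by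
  simpa using h.map_bimodule b p 1

theorem map_mul_C (h : IsFreePair μ S) (p : NCPoly B K) (b : B) :
    μ (p * NCPoly.C K b) = μ p * b := by
  simpa using h.map_bimodule 1 p b

theorem map_C (h : IsFreePair μ S) (b : B) : μ (NCPoly.C K b) = b := by
  simpa [h.map_one] using h.map_C_mul b 1

theorem map_star (h : IsFreePair μ S) {t : Fin 2} {a : NCPoly B K} (ha : a ∈ S t) :
    μ (star a) = star (μ a) := by
  -- The off-diagonal entries of the Gram kernel of (1, a) are μ(a) and μ(a*).
  have hG := h.gram_mem t (Fin 2) ![1, a] (by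
    intro i
    fin_cases i
    · exact one_mem _
    · exact ha)
  simpa [gram] using (posKernel_isHermitian hG 0 1).symm

theorem C_mul_reducedWord (h : IsFreePair μ S) {t : Fin 2} {n : ℕ} {w : NCPoly B K}
    (hw : ReducedWord μ S t n w) (c : B) : ReducedWord μ S t n (NCPoly.C K c * w) := by
  cases hw with
  | const t n b => rw [← map_mul]; exact .const t n _
  | cons hts ha ha0 hw =>
    rw [← mul_assoc]
    exact .cons hts (mul_mem (h.C_mem _ c) ha) (by rw [h.map_C_mul, ha0, mul_zero]) hw

/-- Every reduced word is a product of an element of `S t` and a reduced word that does not start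
in `S t`. -/
theorem exists_mul_of_reducedWord {s : Fin 2} {n : ℕ} {w : NCPoly B K}
    (hw : ReducedWord μ S s n w) (t : Fin 2) :
    ∃ a ∈ S t, ∃ v, ReducedWord μ S t n v ∧ w = a * v := by
  cases hw with
  | const _ _ b => exact ⟨1, one_mem _, _, .const t n b, (one_mul _).symm⟩
  | @cons _ r n a w hts ha ha0 hw =>
    by_cases hrt : t = r
    · subst hrt
      exact ⟨a, ha, w, hw.mono (Nat.le_succ n), rfl⟩
    · exact ⟨1, one_mem _, _, .cons hrt ha ha0 hw, (one_mul _).symm⟩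

/-- Reversing and starring the letters of v, then appending a and the letters of w, gives an
alternating centred word, to which freeness applies. The outer coefficients come out by the bimodule
property. -/
theorem map_star_mul_centred_mul (h : IsFreePair μ S) {t : Fin 2} {n m : ℕ}
    {v w a : NCPoly B K} (hv : ReducedWord μ S t n v) (hw : ReducedWord μ S t m w)
    (ha : a ∈ S t) (ha0 : μ a = 0) : μ (star v * a * w) = 0 := by
  obtain ⟨l, b, rfl, hl, hc⟩ := hv.exists_list
  obtain ⟨l', b', rfl, hl', hc'⟩ := hw.exists_list
  have key := h.free (((l.map fun s => (s.1, star s.2)).reverse) ++ (t, a) :: l') (by simp)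
    (by
      intro s hs
      simp only [List.mem_append, List.mem_reverse, List.mem_map, List.mem_cons] at hs
      rcases hs with ⟨r, hr, rfl⟩ | rfl | hs
      · exact ⟨h.star_mem _ _ (hl r hr).1, by rw [h.map_star (hl r hr).1, (hl r hr).2, star_zero]⟩
      · exact ⟨ha, ha0⟩
      · exact hl' s hs)
    (by
      have h1 : (((t, a) :: l).map fun s => (s.1, star s.2)).reverse.IsChain
          (fun s t : Fin 2 × NCPoly B K => s.1 ≠ t.1) := by
        rw [List.isChain_reverse, List.isChain_map]
        exact (hc a).imp fun _ _ h => h.symm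
      rw [List.map_cons, List.reverse_cons] at h1
      rw [List.isChain_append] at h1 ⊢
      refine ⟨h1.1, hc' a, fun x hx y hy => ?_⟩
      have := h1.2.2 x hx (t, star a) (by simp)
      simp only [List.head?_cons, Option.mem_def, Option.some.injEq] at hy
      subst hy
      exact this)
  have hstar : star (l.map fun s => s.2).prod =
      ((l.map fun s => (s.1, star s.2)).reverse.map fun s => s.2).prod := by
    clear hl hc key hv
    induction l with
    | nil => simp
    | cons s l ih => rw [List.map_cons, List.prod_cons, star_mul, ih]; simp
  rw [star_mul, NCPoly.star_C, hstar]
  rw [List.map_append, List.prod_append, List.map_cons, List.prod_cons] at key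
  have := h.map_bimodule (star b) (((l.map fun s => (s.1, star s.2)).reverse.map fun s => s.2).prod
    * (a * (l'.map fun s => s.2).prod)) b'
  rw [key, mul_zero, zero_mul] at this
  simpa only [mul_assoc] using this

theorem map_star_mul_mul (h : IsFreePair μ S) {t : Fin 2} {n m : ℕ}
    {v w a : NCPoly B K} (hv : ReducedWord μ S t n v) (hw : ReducedWord μ S t m w)
    (ha : a ∈ S t) : μ (star v * a * w) = μ (star v * NCPoly.C K (μ a) * w) := by
  have := h.map_star_mul_centred_mul hv hw (sub_mem ha (h.C_mem t (μ a)))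
    (by rw [map_sub, h.map_C, sub_self])
  rwa [mul_sub, sub_mul, map_sub, sub_eq_zero] at this

/-- Replacing a_i* a_j by its mean turns the entries into μ(v_i* G_ij v_j), with G the Gram kernel
of the a_i. This is additive in G, and for G_ij = c_i* c_j it is the Gram kernel of the words c_i
v_i, which are reduced of the same type as the v_i. -/
theorem gram_mul_mem_posKernel (h : IsFreePair μ S) {t : Fin 2} {n : ℕ} {ι : Type} [Finite ι]
    (hn : ∀ v : ι → NCPoly B K, (∀ i, ReducedWord μ S t n (v i)) → gram μ v ∈ posKernel ι B)
    {a v : ι → NCPoly B K} (ha : ∀ i, a i ∈ S t) (hv : ∀ i, ReducedWord μ S t n (v i)) :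
    gram μ (fun i => a i * v i) ∈ posKernel ι B := by
  have h1 : gram μ (fun i => a i * v i) = Matrix.of fun i j =>
      μ (star (v i) * NCPoly.C K (gram μ a i j) * v j) := by
    ext i j
    simp only [gram, Matrix.of_apply]
    rw [← h.map_star_mul_mul (hv i) (hv j) (mul_mem (h.star_mem _ _ (ha i)) (ha j)), star_mul]
    simp only [mul_assoc]
  rw [h1]
  have hG := h.gram_mem t ι a ha
  clear h1
  generalize gram μ a = G at hG ⊢
  induction hG using AddSubmonoid.closure_induction with
  | mem G hG =>
    obtain ⟨c, rfl⟩ := hG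
    convert hn (fun i => NCPoly.C K (c i) * v i) (fun i => h.C_mul_reducedWord (hv i) _) using 1
    ext i j
    simp [gram, mul_assoc]
  | zero => convert zero_mem (posKernel ι B) using 1; ext i j; simp
  | add G H _ _ hG hH =>
    convert add_mem hG hH using 1
    ext i j
    simp [mul_add, add_mul]

theorem gram_reducedWord_mem_posKernel (h : IsFreePair μ S) {n : ℕ} {ι : Type} [Finite ι]
    (t : Fin 2) (v : ι → NCPoly B K) (hv : ∀ i, ReducedWord μ S t n (v i)) :
    gram μ v ∈ posKernel ι B := by
  induction n generalizing t v with
  | zero =>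
    have hb : ∀ i, ∃ b, v i = NCPoly.C K b := fun i => by
      have := hv i
      generalize v i = w at this
      cases this with
      | const _ _ b => exact ⟨b, rfl⟩
    choose b hb using hb
    convert rankOne_mem_posKernel b using 1
    ext i j
    simp only [gram, Matrix.of_apply, hb, NCPoly.star_C]
    rw [← map_mul, h.map_C]
  | succ n ih =>
    -- With only two factors, all nonconstant words avoiding `S t` at the start begin in the same
    -- factor, so their first letters share one positive Gram kernel.
    obtain ⟨s, hs⟩ : ∃ s : Fin 2, ∀ r, t ≠ r → r = s := by
      fin_cases t
      · exact ⟨1, fun r hr => by fin_cases r <;> simp_all⟩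
      · exact ⟨0, fun r hr => by fin_cases r <;> simp_all⟩
    have hex : ∀ i, ∃ a ∈ S s, ∃ w, ReducedWord μ S s n w ∧ v i = a * w := fun i => by
      have := hv i
      generalize v i = w at this
      cases this with
      | const _ _ b => exact ⟨1, one_mem _, _, .const s n b, (one_mul _).symm⟩
      | cons hts ha _ hw =>
        obtain rfl := hs _ hts
        exact ⟨_, ha, _, hw, rfl⟩
    choose a ha w hw hv' using hex
    obtain rfl : v = fun i => a i * w i := funext hv'
    exact h.gram_mul_mem_posKernel (ih s) ha hw

/-- The reduced words span. -/
theorem mem_closure_reducedWord (h : IsFreePair μ S) (p : NCPoly B K) :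
    p ∈ AddSubmonoid.closure {w | ∃ t n, ReducedWord μ S t n w} := by
  set U := AddSubmonoid.closure {w | ∃ t n, ReducedWord μ S t n w}
  have hmem : ∀ {t n w}, ReducedWord μ S t n w → w ∈ U := fun hw =>
    AddSubmonoid.subset_closure ⟨_, _, hw⟩
  have hmul : ∀ t, ∀ a ∈ S t, ∀ u ∈ U, a * u ∈ U := by
    intro t a ha u hu
    induction hu using AddSubmonoid.closure_induction with
    | mem w hw =>
      obtain ⟨s, n, hw⟩ := hw
      obtain ⟨a', ha', v, hv, rfl⟩ := exists_mul_of_reducedWord hw t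
      -- The product a a' of neighbours from the same factor is split into its centred part and its
      -- mean.
      have hdec : a * (a' * v) = (a * a' - NCPoly.C K (μ (a * a'))) * v +
          NCPoly.C K (μ (a * a')) * v := by
        rw [sub_mul, sub_add_cancel, mul_assoc]
      rw [hdec]
      have haa := mul_mem ha ha'
      refine add_mem ?_ (hmem (h.C_mul_reducedWord hv _))
      -- In `Fin 2`, `t + 1` is the other index.
      exact hmem (.cons (t := t + 1) (by fin_cases t <;> simp) (sub_mem haa (h.C_mem t _))
        (by rw [map_sub, h.map_C, sub_self]) hv)
    | zero => rw [mul_zero]; exact zero_mem _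
    | add x y _ _ hx hy => rw [mul_add]; exact add_mem hx hy
  have hall : ∀ p, ∀ u ∈ U, p * u ∈ U := by
    intro p
    induction p using NCPoly.induction with
    | hC b => exact hmul 0 _ (h.C_mem 0 b)
    | hX k => obtain ⟨t, ht⟩ := h.X_mem k; exact hmul t _ ht
    | hadd p q hp hq => intro u hu; rw [add_mul]; exact add_mem (hp u hu) (hq u hu)
    | hmul p q hp hq => intro u hu; rw [mul_assoc]; exact hp _ (hq u hu)
  have h1 : (1 : NCPoly B K) ∈ U := by
    rw [← _root_.map_one (NCPoly.C K)]
    exact hmem (.const 0 0 1)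
  simpa using hall p 1 h1

/-- Each polynomial is a sum of reduced words. Peeling a possibly trivial factor in `S 0` off every
word brings words with different starts into one common form, so that they fit in a single Gram
kernel; block sums then recover the polynomials. -/
theorem gram_mem_posKernel (h : IsFreePair μ S) {n : ℕ} (p : Fin n → NCPoly B K) :
    gram μ p ∈ posKernel (Fin n) B := by
  have hl : ∀ i, ∃ l : List (NCPoly B K), (∀ w ∈ l, ∃ t n, ReducedWord μ S t n w) ∧ l.sum = p i :=
    fun i => AddSubmonoid.exists_list_of_mem_closure (h.mem_closure_reducedWord (p i))
  choose l hl hp using hl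
  let w : (Σ i, Fin (l i).length) → NCPoly B K := fun x => (l x.1)[x.2]
  have hw : ∀ x, ∃ t n, ReducedWord μ S t n (w x) := fun x => hl x.1 _ (List.getElem_mem _)
  choose t N hw using hw
  obtain ⟨M, hM⟩ : ∃ M, ∀ x, N x ≤ M :=
    ⟨Finset.univ.sup N, fun x => Finset.le_sup (Finset.mem_univ x)⟩
  have hex := fun x => exists_mul_of_reducedWord ((hw x).mono (hM x)) 0
  choose a ha v hv hav using hex
  have hG : gram μ w ∈ posKernel _ B := by
    rw [funext hav]
    exact h.gram_mul_mem_posKernel (h.gram_reducedWord_mem_posKernel 0) ha hv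
  convert blockSum_mem_posKernel hG using 1
  have hsum : ∀ i, p i = ∑ k, w ⟨i, k⟩ := fun i => by
    rw [← hp i]
    exact (Fin.sum_univ_getElem (l i)).symm
  ext i j
  simp only [gram, Matrix.of_apply, hsum, star_sum, Finset.sum_mul_sum, map_sum]

theorem completelyPositive (h : IsFreePair μ S) (n : ℕ)
    (p : Matrix (Fin n) (Fin n) (NCPoly B K)) :
    ∃ c : Matrix (Fin n) (Fin n) B, (p.conjTranspose * p).map μ = c.conjTranspose * c := by
  apply exists_eq_conjTranspose_mul_self_of_mem_posKernel
  have hsum : (p.conjTranspose * p).map μ = ∑ r, gram μ (p r) := by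
    ext i j
    simp [gram, Matrix.mul_apply, Matrix.sum_apply]
  rw [hsum]
  exact sum_mem fun r _ => h.gram_mem_posKernel (p r)

/-- A `B`-bimodule map is determined by its restrictions to free subalgebras. -/
theorem eq_of_free (h : IsFreePair μ S) {ν : NCPoly B K →ₗ[ℂ] B}
    (hν : ∀ t, ∀ a ∈ S t, ν a = μ a) (hbim : ∀ p b, ν (p * NCPoly.C K b) = ν p * b)
    (hfree : IsFreeOver ν S) : ν = μ := by
  ext p
  induction h.mem_closure_reducedWord p using AddSubmonoid.closure_induction with
  | mem w hw =>
    obtain ⟨t, n, hw⟩ := hw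
    obtain ⟨l, b, rfl, hl, hc⟩ := hw.exists_list
    rw [hbim, h.map_mul_C]
    congr 1
    -- Freeness says nothing about the empty word; there both maps are compared at 1, which lies in
    -- `S 0`.
    by_cases hl0 : l = []
    · subst hl0
      exact hν 0 _ (one_mem _)
    · rw [h.free l hl0 hl (hc 0).of_cons,
        hfree l hl0 (fun s hs => ⟨(hl s hs).1, by rw [hν _ _ (hl s hs).1, (hl s hs).2]⟩)
          (hc 0).of_cons]
  | zero => simp
  | add x y _ _ hx hy => rw [map_add, map_add, hx, hy]

end IsFreePair

end Free


/-! ### The action of a free factor on noncommutative polynomials -/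

namespace NCPoly

open TensorProduct

section Basic

variable {B : Type u} [Ring B] [Algebra ℂ B] {I : Type v}

@[simp]
theorem rename_C {K : Type w} (f : I → K) (b : B) : rename f (C I b) = C K b := lift_C _ _ _

@[simp]
theorem rename_X {K : Type w} (f : I → K) (i : I) : rename f (X B i) = X B (f i) := lift_X _ _ _

/-- The augmentation, which maps every variable to `0`. -/
def aug (B : Type u) [Ring B] [Algebra ℂ B] (I : Type v) : NCPoly B I →ₐ[ℂ] B :=
  lift (AlgHom.id ℂ B) fun _ => 0

@[simp]
theorem aug_C (b : B) : aug B I (C I b) = b := lift_C _ _ _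

@[simp]
theorem aug_X (i : I) : aug B I (X B i) = 0 := lift_X _ _ _

theorem aug_rename {K : Type w} (f : I → K) (a : NCPoly B I) :
    aug B K (rename f a) = aug B I a := by
  induction a using NCPoly.induction with
  | hC b => simp
  | hX i => simp
  | hadd p q hp hq => rw [map_add, map_add, map_add, hp, hq]
  | hmul p q hp hq => rw [map_mul, map_mul, map_mul, hp, hq]

/-- The linear map `a ↦ a - μ(a) + ν(a)`. -/
def shift (μ ν : NCPoly B I →ₗ[ℂ] B) : NCPoly B I →ₗ[ℂ] NCPoly B I :=
  LinearMap.id - (C I).toLinearMap ∘ₗ μ + (C I).toLinearMap ∘ₗ ν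

theorem shift_apply (μ ν : NCPoly B I →ₗ[ℂ] B) (a : NCPoly B I) :
    shift μ ν a = a - C I (μ a) + C I (ν a) := rfl

/-- Since both maps fix the constants, the two shifts cancel. This makes encoding and decoding
mutually inverse. -/
theorem shift_shift {μ ν : NCPoly B I →ₗ[ℂ] B} (hμ : ∀ b, μ (C I b) = b)
    (hν : ∀ b, ν (C I b) = b) (a : NCPoly B I) : shift ν μ (shift μ ν a) = a := by
  simp only [shift_apply, map_add, map_sub, hμ, hν]
  abel

theorem shift_C_mul {μ ν : NCPoly B I →ₗ[ℂ] B} (hμ : ∀ b p, μ (C I b * p) = b * μ p)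
    (hν : ∀ b p, ν (C I b * p) = b * ν p) (b : B) (a : NCPoly B I) :
    shift μ ν (C I b * a) = C I b * shift μ ν a := by
  simp only [shift_apply, hμ, hν, map_mul, mul_add, mul_sub]

theorem shift_mul_C {μ ν : NCPoly B I →ₗ[ℂ] B} (hμ : ∀ p b, μ (p * C I b) = μ p * b)
    (hν : ∀ p b, ν (p * C I b) = ν p * b) (a : NCPoly B I) (b : B) :
    shift μ ν (a * C I b) = shift μ ν a * C I b := by
  simp only [shift_apply, hμ, hν, map_mul, add_mul, sub_mul]

end Basic

/-! ### Splitting off the initial block of variables from one factor -/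

section Split

variable {B : Type u} [Ring B] [Algebra ℂ B] {I : Type v} {K : Type w}

/-- Multiplication of the two tensor factors. -/
def mulTensor (f : I → K) : NCPoly B I ⊗[ℂ] NCPoly B K →ₗ[ℂ] NCPoly B K :=
  TensorProduct.lift ((LinearMap.mul ℂ (NCPoly B K)) ∘ₗ (rename f).toLinearMap)

@[simp]
theorem mulTensor_tmul (f : I → K) (a : NCPoly B I) (p : NCPoly B K) :
    mulTensor f (a ⊗ₜ p) = rename f a * p := rfl

/-- Left multiplication on the first tensor factor. -/
def leftMulTensor (B : Type u) [Ring B] [Algebra ℂ B] (I : Type v) (K : Type w) :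
    NCPoly B I →ₐ[ℂ] Module.End ℂ (NCPoly B I ⊗[ℂ] NCPoly B K) :=
  (Module.End.rTensorAlgHom ℂ (NCPoly B I) (NCPoly B K)).comp (Algebra.lmul ℂ (NCPoly B I))

@[simp]
theorem leftMulTensor_tmul (a a' : NCPoly B I) (p : NCPoly B K) :
    leftMulTensor B I K a (a' ⊗ₜ p) = (a * a') ⊗ₜ p := rfl

/-- The representation that keeps the initial block of variables from `I` in the first factor. -/
def splitHom (B : Type u) [Ring B] [Algebra ℂ B] (f : I → K) (d : K → Option I) :
    NCPoly B K →ₐ[ℂ] Module.End ℂ (NCPoly B I ⊗[ℂ] NCPoly B K) :=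
  lift ((leftMulTensor B I K).comp (C I)) fun k =>
    (d k).elim
      -- A variable outside I ends the initial block: everything to its right is multiplied together
      -- and a new empty block is opened.
      (TensorProduct.mk ℂ _ _ 1 ∘ₗ LinearMap.mulLeft ℂ (X B k) ∘ₗ mulTensor f)
      (fun i => leftMulTensor B I K (X B i))

theorem splitHom_rename {f : I → K} {d : K → Option I} (hd : Function.IsPartialInv f d)
    (a : NCPoly B I) : splitHom B f d (rename f a) = leftMulTensor B I K a := by
  induction a using NCPoly.induction with
  | hC b => simp [splitHom]
  | hX i => simp [splitHom, (hd i (f i)).mpr rfl]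
  | hadd p q hp hq => rw [map_add, map_add, map_add, hp, hq]
  | hmul p q hp hq => rw [map_mul, map_mul, map_mul, hp, hq]

theorem splitHom_X {f : I → K} {d : K → Option I} {k : K} (hk : d k = none)
    (u : NCPoly B I ⊗[ℂ] NCPoly B K) :
    splitHom B f d (X B k) u = 1 ⊗ₜ (X B k * mulTensor f u) := by
  simp [splitHom, hk]

theorem mulTensor_leftMulTensor (f : I → K) (a : NCPoly B I)
    (u : NCPoly B I ⊗[ℂ] NCPoly B K) :
    mulTensor f (leftMulTensor B I K a u) = rename f a * mulTensor f u := by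
  induction u with
  | zero => simp
  | tmul a' p => simp [mul_assoc]
  | add x y hx hy => rw [map_add, map_add, map_add, hx, hy, mul_add]

/-- Multiplication of the legs intertwines this representation with left multiplication, as is
checked on generators. Hence splitting loses nothing. -/
theorem mulTensor_splitHom {f : I → K} {d : K → Option I} (hd : Function.IsPartialInv f d)
    (p : NCPoly B K) (u : NCPoly B I ⊗[ℂ] NCPoly B K) :
    mulTensor f (splitHom B f d p u) = p * mulTensor f u := by
  induction p using NCPoly.induction generalizing u with
  | hC b =>
    rw [← rename_C f, splitHom_rename hd, mulTensor_leftMulTensor]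
  | hX k =>
    cases hk : d k with
    | none => rw [splitHom_X hk]; simp
    | some i =>
      obtain rfl := (hd i k).mp hk
      rw [← rename_X f, splitHom_rename hd, mulTensor_leftMulTensor]
  | hadd p q hp hq => rw [map_add, LinearMap.add_apply, map_add, hp, hq, add_mul]
  | hmul p q hp hq => rw [map_mul, Module.End.mul_apply, hp, hq, mul_assoc]

/-- Splits off the initial block of variables from `I`. -/
def split (B : Type u) [Ring B] [Algebra ℂ B] (f : I → K) (d : K → Option I) :
    NCPoly B K →ₗ[ℂ] NCPoly B I ⊗[ℂ] NCPoly B K :=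
  LinearMap.applyₗ (1 ⊗ₜ 1) ∘ₗ (splitHom B f d).toLinearMap

theorem split_apply (f : I → K) (d : K → Option I) (p : NCPoly B K) :
    split B f d p = splitHom B f d p (1 ⊗ₜ 1) := rfl

theorem split_rename_mul {f : I → K} {d : K → Option I} (hd : Function.IsPartialInv f d)
    (a : NCPoly B I) (p : NCPoly B K) :
    split B f d (rename f a * p) = leftMulTensor B I K a (split B f d p) := by
  rw [split_apply, map_mul, splitHom_rename hd]
  rfl

/-- Polynomials that are `1` or start with a variable that does not come from `I`. -/
def IsTail (B : Type u) [Ring B] [Algebra ℂ B] (d : K → Option I) (w : NCPoly B K) : Prop :=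
  w = 1 ∨ ∃ k p, d k = none ∧ w = X B k * p

theorem IsTail.split_eq {f : I → K} {d : K → Option I} (hd : Function.IsPartialInv f d)
    {w : NCPoly B K} (hw : IsTail B d w) : split B f d w = 1 ⊗ₜ w := by
  rcases hw with rfl | ⟨k, p, hk, rfl⟩
  · simp [split_apply]
  · rw [split_apply, map_mul, Module.End.mul_apply, splitHom_X hk, mulTensor_splitHom hd]
    simp

theorem mem_span_rename_mul_tail {f : I → K} {d : K → Option I}
    (hd : Function.IsPartialInv f d) (p : NCPoly B K) :
    p ∈ AddSubmonoid.closure {q | ∃ a w, IsTail B d w ∧ q = rename f a * w} := by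
  set U := AddSubmonoid.closure {q | ∃ a w, IsTail B d w ∧ q = rename f a * w}
  have hmem : ∀ a w, IsTail B d w → rename f a * w ∈ U := fun a w hw =>
    AddSubmonoid.subset_closure ⟨a, w, hw, rfl⟩
  have hmul : ∀ a, ∀ u ∈ U, rename f a * u ∈ U := by
    intro a u hu
    induction hu using AddSubmonoid.closure_induction with
    | mem u hu =>
      obtain ⟨a', w, hw, rfl⟩ := hu
      rw [← mul_assoc, ← map_mul]
      exact hmem _ _ hw
    | zero => rw [mul_zero]; exact zero_mem _
    | add x y _ _ hx hy => rw [mul_add]; exact add_mem hx hy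
  have hall : ∀ p, ∀ u ∈ U, p * u ∈ U := by
    intro p
    induction p using NCPoly.induction with
    | hC b => rw [← rename_C f]; exact hmul _
    | hX k =>
      cases hk : d k with
      | none =>
        intro u _
        simpa using hmem 1 (X B k * u) (Or.inr ⟨k, u, hk, rfl⟩)
      | some i =>
        obtain rfl := (hd i k).mp hk
        rw [← rename_X f]
        exact hmul _
    | hadd p q hp hq => intro u hu; rw [add_mul]; exact add_mem (hp u hu) (hq u hu)
    | hmul p q hp hq => intro u hu; rw [mul_assoc]; exact hp _ (hq u hu)
  simpa using hall p 1 (by simpa using hmem 1 1 (Or.inl rfl))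

end Split

/-! ### The action of one factor through encoding and decoding -/

section Action

variable {B : Type u} [CStarAlgebra B] {I : Type v} {K : Type w}

/-- The encoding `a - ε(a) + μ(a)`, which maps the kernel of `μ` to that of the augmentation. -/
def encode (μ : NCPoly B I →ₗ[ℂ] B) : NCPoly B I →ₗ[ℂ] NCPoly B I :=
  shift (aug B I).toLinearMap μ

/-- The inverse `a - μ(a) + ε(a)` of the encoding. -/
def decode (μ : NCPoly B I →ₗ[ℂ] B) : NCPoly B I →ₗ[ℂ] NCPoly B I :=
  shift μ (aug B I).toLinearMap

/-- The action of `B⟨x_i; i ∈ I⟩` on `B⟨x_k; k ∈ K⟩` in which a product `p₁ p₂ ⋯` of polynomials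
without constant term from alternating factors stands for the product of the `p_j - μ(p_j)`. -/
def act (μ : NCPoly B I →ₗ[ℂ] B) (f : I → K) (d : K → Option I) :
    NCPoly B I →ₗ[ℂ] Module.End ℂ (NCPoly B K) where
  toFun a := mulTensor f ∘ₗ (encode μ ∘ₗ LinearMap.mulLeft ℂ a ∘ₗ decode μ).rTensor _ ∘ₗ
    split B f d
  map_add' a b := by
    rw [show LinearMap.mulLeft ℂ (a + b) = LinearMap.mulLeft ℂ a + LinearMap.mulLeft ℂ b from
      map_add (LinearMap.mul ℂ _) a b]
    simp only [LinearMap.add_comp, LinearMap.comp_add, LinearMap.rTensor_add]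
  map_smul' c a := by
    rw [show LinearMap.mulLeft ℂ (c • a) = c • LinearMap.mulLeft ℂ a from
      map_smul (LinearMap.mul ℂ _) c a]
    simp only [LinearMap.smul_comp, LinearMap.comp_smul, LinearMap.rTensor_smul, RingHom.id_apply]

variable {μ : NCPoly B I →ₗ[ℂ] B} {f : I → K} {d : K → Option I}

theorem aug_encode (a : NCPoly B I) :
    aug B I (encode μ a) = μ a := by
  simp [encode, shift_apply]

theorem decode_encode (hμ : IsJointDistribution μ) (a : NCPoly B I) :
    decode μ (encode μ a) = a :=
  shift_shift (fun b => aug_C b) hμ.map_C a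

theorem encode_decode (hμ : IsJointDistribution μ) (a : NCPoly B I) :
    encode μ (decode μ a) = a :=
  shift_shift hμ.map_C (fun b => aug_C b) a

theorem encode_C_mul (hμ : IsJointDistribution μ) (b : B) (a : NCPoly B I) :
    encode μ (C I b * a) = C I b * encode μ a :=
  shift_C_mul (by simp) hμ.map_C_mul b a

theorem encode_mul_C (hμ : IsJointDistribution μ) (a : NCPoly B I) (b : B) :
    encode μ (a * C I b) = encode μ a * C I b :=
  shift_mul_C (by simp) hμ.map_mul_C a b

theorem decode_mul_C (hμ : IsJointDistribution μ) (a : NCPoly B I) (b : B) :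
    decode μ (a * C I b) = decode μ a * C I b :=
  shift_mul_C hμ.map_mul_C (by simp) a b

theorem decode_C (hμ : IsJointDistribution μ) (b : B) : decode μ (C I b) = C I b := by
  simp [decode, shift_apply, hμ.map_C]

theorem decode_one (hμ : IsJointDistribution μ) : decode μ 1 = 1 := by
  simpa using decode_C hμ 1

/-- The polynomials that do not interact with the action of `B⟨x_i; i ∈ I⟩`. -/
def inertSubmodule (μ : NCPoly B I →ₗ[ℂ] B) (f : I → K) (d : K → Option I) :
    Submodule ℂ (NCPoly B K) where
  carrier := {w | ∀ a c, act μ f d a (rename f c * w) =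
    rename f (encode μ (a * decode μ c)) * w}
  zero_mem' a c := by simp
  add_mem' hx hy a c := by rw [mul_add, map_add, hx, hy, mul_add]
  smul_mem' r x hx a c := by rw [mul_smul_comm, map_smul, hx, mul_smul_comm]

theorem IsTail.mem_inert (hd : Function.IsPartialInv f d) {w : NCPoly B K}
    (hw : IsTail B d w) : w ∈ inertSubmodule μ f d := by
  intro a c
  change mulTensor f (LinearMap.rTensor _ _ (split B f d (rename f c * w))) = _
  rw [split_rename_mul hd, hw.split_eq hd, leftMulTensor_tmul, LinearMap.rTensor_tmul, mul_one]
  rfl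

/-- The coefficient b can be absorbed into the preceding block c, because encoding and decoding are
right B-linear. -/
theorem C_mul_mem_inert (hμ : IsJointDistribution μ) {w : NCPoly B K}
    (hw : w ∈ inertSubmodule μ f d) (b : B) : C K b * w ∈ inertSubmodule μ f d := by
  intro a c
  have h := hw a (c * C I b)
  rw [decode_mul_C hμ, ← mul_assoc, encode_mul_C hμ, map_mul (rename f), map_mul (rename f),
    rename_C, mul_assoc, mul_assoc] at h
  exact h

/-- A polynomial without constant term in foreign variables is a sum of terms that start, up to a
coefficient, with a foreign variable. The induction rests on qr - ε(q)ε(r) = (q - ε(q)) r + ε(q)(r -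
ε(r)). -/
theorem rename_sub_aug_mul_mem_inert {J : Type*} (hμ : IsJointDistribution μ)
    (hd : Function.IsPartialInv f d) {g : J → K} (hg : ∀ j, d (g j) = none) (q : NCPoly B J)
    (p : NCPoly B K) : rename g (q - C J (aug B J q)) * p ∈ inertSubmodule μ f d := by
  induction q using NCPoly.induction generalizing p with
  | hC b => simp
  | hX j => exact IsTail.mem_inert hd (Or.inr ⟨g j, p, hg j, by simp⟩)
  | hadd q r hq hr =>
    convert add_mem (hq p) (hr p) using 1
    simp only [map_add, map_sub]
    noncomm_ring
  | hmul q r hq hr =>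
    convert add_mem (hq (rename g r * p)) (C_mul_mem_inert hμ (hr p) (aug B J q)) using 1
    simp only [map_mul, map_sub, rename_C]
    noncomm_ring

theorem act_rename_mul (hμ : IsJointDistribution μ) {w : NCPoly B K}
    (hw : w ∈ inertSubmodule μ f d) (a : NCPoly B I) :
    act μ f d a w = rename f (encode μ a) * w := by
  have h := hw a 1
  rwa [map_one, one_mul, decode_one hμ, mul_one] at h

/-- Two additive maps agree if they agree on the products of a polynomial in `I` and a tail. -/
theorem addHom_ext_tail (hd : Function.IsPartialInv f d) {A : Type*} [AddCommGroup A]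
    {φ ψ : NCPoly B K →+ A}
    (h : ∀ c w, IsTail B d w → φ (rename f c * w) = ψ (rename f c * w)) : φ = ψ := by
  ext p
  induction mem_span_rename_mul_tail hd p using AddSubmonoid.closure_induction with
  | mem q hq => obtain ⟨c, w, hw, rfl⟩ := hq; exact h c w hw
  | zero => simp
  | add x y _ _ hx hy => rw [map_add, map_add, hx, hy]

/-- On a block times a tail, the encoding done by b is undone by the decoding done by a. -/
theorem act_mul (hμ : IsJointDistribution μ) (hd : Function.IsPartialInv f d)
    (a b : NCPoly B I) : act μ f d (a * b) = act μ f d a * act μ f d b := by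
  have := addHom_ext_tail hd (φ := (act μ f d (a * b)).toAddMonoidHom)
    (ψ := (act μ f d a * act μ f d b).toAddMonoidHom) (by
      intro c w hw
      have hw' := hw.mem_inert (μ := μ) hd
      change act μ f d (a * b) _ = act μ f d a (act μ f d b _)
      rw [hw' (a * b) c, hw' b c, hw' a, decode_encode hμ, mul_assoc])
  ext p
  exact DFunLike.congr_fun this p

theorem act_C (hμ : IsJointDistribution μ) (hd : Function.IsPartialInv f d) (b : B)
    (p : NCPoly B K) : act μ f d (C I b) p = C K b * p := by
  have := addHom_ext_tail hd (φ := (act μ f d (C I b)).toAddMonoidHom)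
    (ψ := AddMonoidHom.mulLeft (C K b)) (by
      intro c w hw
      change act μ f d (C I b) _ = C K b * _
      rw [hw.mem_inert (μ := μ) hd, encode_C_mul hμ, encode_decode hμ, map_mul, rename_C,
        mul_assoc])
  exact DFunLike.congr_fun this p

theorem act_mul_C (hμ : IsJointDistribution μ) (hd : Function.IsPartialInv f d)
    (a : NCPoly B I) (p : NCPoly B K) (b : B) :
    act μ f d a (p * C K b) = act μ f d a p * C K b := by
  have := addHom_ext_tail hd
    (φ := (act μ f d a).toAddMonoidHom.comp (AddMonoidHom.mulRight (C K b)))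
    (ψ := (AddMonoidHom.mulRight (C K b)).comp (act μ f d a).toAddMonoidHom) (by
      intro c w hw
      -- The tail 1 becomes the constant b, which is no longer a tail but is still inert.
      have hwb : w * C K b ∈ inertSubmodule μ f d := by
        rcases hw with rfl | ⟨k, q, hk, rfl⟩
        · simpa using C_mul_mem_inert hμ (IsTail.mem_inert hd (Or.inl rfl)) b
        · exact IsTail.mem_inert hd (Or.inr ⟨k, q * C K b, hk, mul_assoc _ _ _⟩)
      change act μ f d a (_ * C K b) = act μ f d a _ * C K b
      rw [hw.mem_inert (μ := μ) hd, mul_assoc, mul_assoc, hwb])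
  exact DFunLike.congr_fun this p

end Action

end NCPoly


/-! ### Exponential bounds -/

namespace NCPoly

section Bound

variable {B : Type u} [CStarAlgebra B] {I : Type v} {K : Type w}

theorem norm_one_le_one (B : Type u) [CStarAlgebra B] : ‖(1 : B)‖ ≤ 1 := by
  rcases subsingleton_or_nontrivial B with h | h
  · rw [Subsingleton.elim (1 : B) 0, norm_zero]; exact zero_le_one
  · exact CStarRing.norm_one.le

/-- `MonomialBound R p r`: `p` is a monomial `b₀ x_{i₁} b₁ ⋯ x_{i_n} b_n` with
`R ^ n ‖b₀‖ ⋯ ‖b_n‖ ≤ r`. -/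
inductive MonomialBound (R : ℝ) : NCPoly B I → ℝ → Prop
  | const (b : B) (r : ℝ) (h : ‖b‖ ≤ r) : MonomialBound R (C I b) r
  | cons (b : B) (i : I) (p : NCPoly B I) (r r' : ℝ) (hp : MonomialBound R p r)
      (h : ‖b‖ * (R * r) ≤ r') : MonomialBound R (C I b * (X B i * p)) r'

/-- `PolyBound R p r`: `p` is a sum of monomials whose bounds for the radius `R` add up to at
most `r`. -/
inductive PolyBound (R : ℝ) : NCPoly B I → ℝ → Prop
  | of {p : NCPoly B I} {r : ℝ} (h : MonomialBound R p r) : PolyBound R p r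
  | add {p q : NCPoly B I} {r s t : ℝ} (hp : PolyBound R p r) (hq : PolyBound R q s)
      (h : r + s ≤ t) : PolyBound R (p + q) t

variable {R : ℝ}

namespace MonomialBound

theorem one (R : ℝ) : MonomialBound R (1 : NCPoly B I) 1 := by
  rw [← map_one (C I)]
  exact .const 1 1 (norm_one_le_one B)

theorem nonneg (hR : 0 ≤ R) {p : NCPoly B I} {r : ℝ} (h : MonomialBound R p r) : 0 ≤ r := by
  induction h with
  | const b r h => exact (norm_nonneg b).trans h
  | cons b i p r r' _ h ih => exact le_trans (by positivity) h

theorem mono {p : NCPoly B I} {r s : ℝ} (h : MonomialBound R p r) (hrs : r ≤ s) :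
    MonomialBound R p s := by
  cases h with
  | const b _ h => exact .const b s (h.trans hrs)
  | cons b i p r _ hp h => exact .cons b i p r s hp (h.trans hrs)

theorem neg {p : NCPoly B I} {r : ℝ} (h : MonomialBound R p r) : MonomialBound R (-p) r := by
  cases h with
  | const b _ h => rw [← map_neg]; exact .const _ _ (by rwa [norm_neg])
  | cons b i p r _ hp h =>
    rw [← neg_mul, ← map_neg]
    exact .cons _ i p r _ hp (by rwa [norm_neg])

theorem C_mul (hR : 0 ≤ R) (b : B) {p : NCPoly B I} {r : ℝ} (h : MonomialBound R p r) :
    MonomialBound R (C I b * p) (‖b‖ * r) := by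
  cases h with
  | const b' _ h =>
    rw [← map_mul]
    exact .const _ _ ((norm_mul_le _ _).trans (by gcongr))
  | cons b' i p s _ hp h =>
    rw [← mul_assoc, ← map_mul]
    have hs := hp.nonneg hR
    refine .cons _ i p s _ hp ?_
    calc ‖b * b'‖ * (R * s) ≤ ‖b‖ * ‖b'‖ * (R * s) := by gcongr; exact norm_mul_le _ _
      _ = ‖b‖ * (‖b'‖ * (R * s)) := by ring
      _ ≤ ‖b‖ * r := by gcongr

theorem X_mul (hR : 0 ≤ R) (i : I) {p : NCPoly B I} {r : ℝ} (h : MonomialBound R p r) :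
    MonomialBound R (X B i * p) (R * r) := by
  have hr := h.nonneg hR
  have := MonomialBound.cons 1 i p r (R * r) h
    (mul_le_of_le_one_left (by positivity) (norm_one_le_one B))
  simpa using this

theorem mul (hR : 0 ≤ R) {p q : NCPoly B I} {r s : ℝ} (hp : MonomialBound R p r)
    (hq : MonomialBound R q s) : MonomialBound R (p * q) (r * s) := by
  have hs := hq.nonneg hR
  induction hp with
  | const b r h => exact (hq.C_mul hR b).mono (by gcongr)
  | cons b i p r r' _ h ih =>
    rw [mul_assoc, mul_assoc]
    refine ((ih.X_mul hR i).C_mul hR b).mono ?_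
    calc ‖b‖ * (R * (r * s)) = ‖b‖ * (R * r) * s := by ring
      _ ≤ r' * s := by gcongr

theorem rename (f : I → K) {p : NCPoly B I} {r : ℝ} (h : MonomialBound R p r) :
    MonomialBound R (rename f p) r := by
  induction h with
  | const b r h => rw [rename_C]; exact .const b r h
  | cons b i p r r' _ h ih =>
    rw [map_mul, map_mul, rename_C, rename_X]
    exact .cons b _ _ r r' ih h

theorem norm_aug_le (hR : 0 ≤ R) {p : NCPoly B I} {r : ℝ} (h : MonomialBound R p r) :
    ‖aug B I p‖ ≤ r := by
  have hr := h.nonneg hR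
  cases h with
  | const b _ h => rwa [aug_C]
  | cons b i p _ _ _ h => simpa using hr

/-- This brings a monomial into the shape in which the exponential bound is stated, with the outer
coefficients b and b' split off for the bimodule property. -/
theorem normal_form (hR : 0 ≤ R) {p : NCPoly B I} {r : ℝ} (h : MonomialBound R p r) :
    (∃ b, p = C I b ∧ ‖b‖ ≤ r) ∨ ∃ (b : B) (i : I) (l : List (B × I)) (b' : B),
      p = C I b * (X B i * (l.map fun s => C I s.1 * X B s.2).prod) * C I b' ∧
      ‖b‖ * (R ^ (l.length + 1) * (l.map fun s => ‖s.1‖).prod) * ‖b'‖ ≤ r := by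
  induction h with
  | const b r h => exact Or.inl ⟨b, rfl, h⟩
  | cons b i p r r' _ h ih =>
    right
    rcases ih with ⟨b', rfl, hb'⟩ | ⟨b', j, l, b'', rfl, hl⟩
    · refine ⟨b, i, [], b', by simp [mul_assoc], le_trans ?_ h⟩
      calc _ = ‖b‖ * (R * ‖b'‖) := by simp; ring
        _ ≤ _ := by gcongr
    · refine ⟨b, i, (b', j) :: l, b'', by simp [mul_assoc], le_trans ?_ h⟩
      calc _ = ‖b‖ * (R * (‖b'‖ * (R ^ (l.length + 1) * (l.map fun s => ‖s.1‖).prod) * ‖b''‖)) := by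
            simp only [List.length_cons, List.map_cons, List.prod_cons]; ring
        _ ≤ _ := by gcongr

theorem norm_map_le (hR : 0 ≤ R) {μ : NCPoly B I →ₗ[ℂ] B} (hμ : IsJointDistribution μ)
    (hb : ∀ (i : I) (l : List (B × I)), ‖μ (X B i * (l.map fun s => C I s.1 * X B s.2).prod)‖
      ≤ R ^ (l.length + 1) * (l.map fun s => ‖s.1‖).prod)
    {p : NCPoly B I} {r : ℝ} (h : MonomialBound R p r) : ‖μ p‖ ≤ r := by
  rcases h.normal_form hR with ⟨b, rfl, hbr⟩ | ⟨b, i, l, b', rfl, hl⟩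
  · rwa [hμ.map_C]
  · rw [hμ.map_bimodule]
    refine le_trans ?_ hl
    refine (norm_mul_le _ _).trans ?_
    gcongr
    refine (norm_mul_le _ _).trans ?_
    gcongr
    exact hb i l

/-- A monomial is the product of a monomial in the variables from `I` and a tail. -/
theorem exists_rename_mul_tail (hR : 0 ≤ R) {f : I → K} {d : K → Option I}
    (hd : Function.IsPartialInv f d) {p : NCPoly B K} {r : ℝ} (h : MonomialBound R p r) :
    ∃ (a : NCPoly B I) (w : NCPoly B K) (s t : ℝ), MonomialBound R a s ∧ MonomialBound R w t ∧
      IsTail B d w ∧ p = NCPoly.rename f a * w ∧ s * t ≤ r := by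
  induction h with
  | const b r h =>
    exact ⟨C I b, 1, r, 1, .const b r h, MonomialBound.one R, Or.inl rfl,
      by simp, by simp⟩
  | cons b k p r r' hp h ih =>
    cases hk : d k with
    | none =>
      exact ⟨C I b, X B k * p, ‖b‖, R * r, .const b _ le_rfl, hp.X_mul hR k,
        Or.inr ⟨k, p, hk, rfl⟩, by simp, h⟩
    | some i =>
      obtain rfl := (hd i k).mp hk
      obtain ⟨a, w, s, t, ha, hw, hwt, rfl, hst⟩ := ih
      refine ⟨C I b * (X B i * a), w, ‖b‖ * (R * s), t, .cons b i a s _ ha le_rfl, hw, hwt,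
        by simp [mul_assoc], le_trans ?_ h⟩
      calc ‖b‖ * (R * s) * t = ‖b‖ * (R * (s * t)) := by ring
        _ ≤ _ := by gcongr

end MonomialBound

namespace PolyBound

theorem nonneg (hR : 0 ≤ R) {p : NCPoly B I} {r : ℝ} (h : PolyBound R p r) : 0 ≤ r := by
  induction h with
  | of h => exact h.nonneg hR
  | add _ _ h ih ih' => linarith

theorem mono {p : NCPoly B I} {r s : ℝ} (h : PolyBound R p r) (hrs : r ≤ s) :
    PolyBound R p s := by
  cases h with
  | of h => exact .of (h.mono hrs)
  | add hp hq h => exact .add hp hq (h.trans hrs)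

theorem neg {p : NCPoly B I} {r : ℝ} (h : PolyBound R p r) : PolyBound R (-p) r := by
  induction h with
  | of h => exact .of h.neg
  | add _ _ h ih ih' => rw [neg_add]; exact .add ih ih' h

theorem rename (f : I → K) {p : NCPoly B I} {r : ℝ} (h : PolyBound R p r) :
    PolyBound R (rename f p) r := by
  induction h with
  | of h => exact .of (h.rename f)
  | add _ _ h ih ih' => rw [map_add]; exact .add ih ih' h

theorem mul (hR : 0 ≤ R) {p q : NCPoly B I} {r s : ℝ} (hp : PolyBound R p r)
    (hq : PolyBound R q s) : PolyBound R (p * q) (r * s) := by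
  have hs := hq.nonneg hR
  induction hp with
  | @of p r hp =>
    have hr := hp.nonneg hR
    clear hs
    induction hq with
    | of hq => exact .of (hp.mul hR hq)
    | add _ _ h ih ih' =>
      rw [mul_add]
      exact .add ih ih' (by rw [← mul_add]; gcongr)
  | add _ _ h ih ih' =>
    rw [add_mul]
    exact .add ih ih' (by rw [← add_mul]; gcongr)

theorem norm_map_le {φ : NCPoly B I →ₗ[ℂ] B}
    (hφ : ∀ p r, MonomialBound R p r → ‖φ p‖ ≤ r) {p : NCPoly B I} {r : ℝ}
    (h : PolyBound R p r) : ‖φ p‖ ≤ r := by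
  induction h with
  | of h => exact hφ _ _ h
  | add _ _ h ih ih' =>
    rw [map_add]
    exact (norm_add_le _ _).trans ((add_le_add ih ih').trans h)

/-- The factor 3 counts the three terms a, μ(a) and ν(a), each of weight at most r. -/
theorem shift {μ ν : NCPoly B I →ₗ[ℂ] B} (hμ : ∀ p r, MonomialBound R p r → ‖μ p‖ ≤ r)
    (hν : ∀ p r, MonomialBound R p r → ‖ν p‖ ≤ r) {p : NCPoly B I} {r : ℝ}
    (h : PolyBound R p r) : PolyBound R (shift μ ν p) (3 * r) := by
  rw [shift_apply, sub_eq_add_neg]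
  refine .add (.add h (neg (of (.const _ r (h.norm_map_le hμ)))) le_rfl)
    (of (.const _ r (h.norm_map_le hν))) (le_of_eq (by ring))

/-- Decoding the initial block costs a factor 3, the variable a factor R, and encoding another 3;
the tail is untouched. -/
theorem act_X (hR : 0 ≤ R) {μ : NCPoly B I →ₗ[ℂ] B}
    (hμ : ∀ p r, MonomialBound R p r → ‖μ p‖ ≤ r)
    {f : I → K} {d : K → Option I} (hd : Function.IsPartialInv f d) (i : I) {p : NCPoly B K}
    {r : ℝ} (h : PolyBound R p r) : PolyBound R (act μ f d (X B i) p) (9 * R * r) := by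
  have haug : ∀ p r, MonomialBound R p r → ‖(aug B I).toLinearMap p‖ ≤ r :=
    fun p r h => h.norm_aug_le hR
  induction h with
  | of h =>
    obtain ⟨a, w, s, t, ha, hw, hwt, rfl, hst⟩ := h.exists_rename_mul_tail hR hd
    rw [hwt.mem_inert hd]
    have hX : PolyBound R (X B i) R := by
      simpa using of ((MonomialBound.one (B := B) R).X_mul hR i)
    refine mono (mul hR (((hX.mul hR ((of ha).shift hμ haug)).shift haug hμ).rename f)
      (of hw)) ?_
    calc 3 * (R * (3 * s)) * t = 9 * R * (s * t) := by ring
      _ ≤ _ := by gcongr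
  | add _ _ h ih ih' =>
    rw [map_add]
    exact .add ih ih' (by rw [← mul_add]; gcongr)

end PolyBound

end Bound

end NCPoly


/-! ### The free product -/

namespace NCPoly

section FreeProduct

variable {B : Type u} [CStarAlgebra B] {I : Type v} {J : Type w}

theorem isPartialInv_inl : Function.IsPartialInv (Sum.inl : I → I ⊕ J) Sum.getLeft? := by
  intro i k
  cases k <;> simp [eq_comm]

theorem isPartialInv_inr : Function.IsPartialInv (Sum.inr : J → I ⊕ J) Sum.getRight? := by
  intro j k
  cases k <;> simp [eq_comm]

/-- The representation of `B⟨x_i, y_j⟩` on itself in which the two factors act by `act`. -/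
def freeRep (μI : NCPoly B I →ₗ[ℂ] B) (μJ : NCPoly B J →ₗ[ℂ] B) :
    NCPoly B (I ⊕ J) →ₐ[ℂ] Module.End ℂ (NCPoly B (I ⊕ J)) :=
  lift ((Algebra.lmul ℂ _).comp (C (I ⊕ J))) (Sum.elim
    (fun i => act μI Sum.inl Sum.getLeft? (X B i)) (fun j => act μJ Sum.inr Sum.getRight? (X B j)))

/-- The free product `μ_I * μ_J`. -/
def freeProduct (μI : NCPoly B I →ₗ[ℂ] B) (μJ : NCPoly B J →ₗ[ℂ] B) :
    NCPoly B (I ⊕ J) →ₗ[ℂ] B :=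
  (aug B (I ⊕ J)).toLinearMap ∘ₗ LinearMap.applyₗ 1 ∘ₗ (freeRep μI μJ).toLinearMap

variable {μI : NCPoly B I →ₗ[ℂ] B} {μJ : NCPoly B J →ₗ[ℂ] B}

theorem freeProduct_apply (p : NCPoly B (I ⊕ J)) :
    freeProduct μI μJ p = aug B (I ⊕ J) (freeRep μI μJ p 1) := rfl

theorem freeRep_C (b : B) (q : NCPoly B (I ⊕ J)) :
    freeRep μI μJ (C (I ⊕ J) b) q = C (I ⊕ J) b * q := by
  simp [freeRep]

theorem freeRep_rename_inl (hμI : IsJointDistribution μI) (a : NCPoly B I) :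
    freeRep μI μJ (rename Sum.inl a) = act μI Sum.inl Sum.getLeft? a := by
  induction a using NCPoly.induction with
  | hC b => ext q; rw [rename_C, freeRep_C, act_C hμI isPartialInv_inl]
  | hX i => simp [freeRep]
  | hadd p q hp hq => rw [map_add, map_add, map_add, hp, hq]
  | hmul p q hp hq => rw [map_mul, map_mul, act_mul hμI isPartialInv_inl, hp, hq]

theorem freeRep_rename_inr (hμJ : IsJointDistribution μJ) (a : NCPoly B J) :
    freeRep μI μJ (rename Sum.inr a) = act μJ Sum.inr Sum.getRight? a := by
  induction a using NCPoly.induction with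
  | hC b => ext q; rw [rename_C, freeRep_C, act_C hμJ isPartialInv_inr]
  | hX i => simp [freeRep]
  | hadd p q hp hq => rw [map_add, map_add, map_add, hp, hq]
  | hmul p q hp hq => rw [map_mul, map_mul, act_mul hμJ isPartialInv_inr, hp, hq]

theorem freeRep_mul_C (hμI : IsJointDistribution μI) (hμJ : IsJointDistribution μJ)
    (p q : NCPoly B (I ⊕ J)) (b : B) :
    freeRep μI μJ p (q * C (I ⊕ J) b) = freeRep μI μJ p q * C (I ⊕ J) b := by
  induction p using NCPoly.induction generalizing q with
  | hC b' => rw [freeRep_C, freeRep_C, mul_assoc]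
  | hX k =>
    cases k with
    | inl i =>
      rw [← rename_X Sum.inl, freeRep_rename_inl hμI, act_mul_C hμI isPartialInv_inl]
    | inr j =>
      rw [← rename_X Sum.inr, freeRep_rename_inr hμJ, act_mul_C hμJ isPartialInv_inr]
  | hadd p p' hp hp' => rw [map_add, LinearMap.add_apply, hp, hp', LinearMap.add_apply, add_mul]
  | hmul p p' hp hp' =>
    rw [map_mul (freeRep μI μJ), Module.End.mul_apply, hp', hp, Module.End.mul_apply]

theorem freeProduct_one : freeProduct μI μJ 1 = 1 := by
  simp [freeProduct_apply]

theorem freeProduct_bimodule (hμI : IsJointDistribution μI) (hμJ : IsJointDistribution μJ)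
    (b : B) (p : NCPoly B (I ⊕ J)) (b' : B) :
    freeProduct μI μJ (C (I ⊕ J) b * p * C (I ⊕ J) b') = b * freeProduct μI μJ p * b' := by
  have h := freeRep_mul_C hμI hμJ p 1 b'
  rw [one_mul] at h
  simp only [freeProduct_apply, map_mul, Module.End.mul_apply, freeRep_C, mul_one, aug_C, h]
  rw [mul_assoc]

theorem one_mem_inert {K : Type*} {f : I → K} {d : K → Option I}
    (hd : Function.IsPartialInv f d) : (1 : NCPoly B K) ∈ inertSubmodule μI f d :=
  IsTail.mem_inert hd (Or.inl rfl)

theorem freeProduct_rename_inl (hμI : IsJointDistribution μI) (a : NCPoly B I) :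
    freeProduct μI μJ (rename Sum.inl a) = μI a := by
  rw [freeProduct_apply, freeRep_rename_inl hμI, act_rename_mul hμI
    (one_mem_inert isPartialInv_inl), mul_one, aug_rename, aug_encode]

theorem freeProduct_rename_inr (hμJ : IsJointDistribution μJ) (a : NCPoly B J) :
    freeProduct μI μJ (rename Sum.inr a) = μJ a := by
  rw [freeProduct_apply, freeRep_rename_inr hμJ, act_rename_mul hμJ
    (one_mem_inert isPartialInv_inr), mul_one, aug_rename, aug_encode]

/-- By induction the vector produced by the rest of the word is inert for the factor of the new
letter, so that letter only multiplies it by its encoding. The encoding of a centred letter has no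
constant term, so the result is inert for the other factor and is killed by the augmentation. The
head conditions let the empty word serve both factors. -/
theorem freeRep_alternating (hμI : IsJointDistribution μI) (hμJ : IsJointDistribution μJ)
    (l : List (Fin 2 × NCPoly B (I ⊕ J)))
    (hl : ∀ s ∈ l, s.2 ∈ (![(rename (B := B) (Sum.inl : I → I ⊕ J)).range,
      (rename (B := B) (Sum.inr : J → I ⊕ J)).range] : Fin 2 → Subalgebra ℂ _) s.1 ∧
      freeProduct μI μJ s.2 = 0)
    (hc : l.IsChain fun s t => s.1 ≠ t.1) :
    ((∀ s ∈ l.head?, s.1 ≠ 0) → freeRep μI μJ (l.map fun s => s.2).prod 1 ∈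
      inertSubmodule μI Sum.inl Sum.getLeft?) ∧
    ((∀ s ∈ l.head?, s.1 ≠ 1) → freeRep μI μJ (l.map fun s => s.2).prod 1 ∈
      inertSubmodule μJ Sum.inr Sum.getRight?) ∧
    (l ≠ [] → aug B (I ⊕ J) (freeRep μI μJ (l.map fun s => s.2).prod 1) = 0) := by
  induction l with
  | nil =>
    simpa using ⟨one_mem_inert isPartialInv_inl, one_mem_inert isPartialInv_inr⟩
  | cons s l ih =>
    obtain ⟨ih0, ih1, -⟩ := ih (fun s hs => hl s (List.mem_cons_of_mem _ hs)) hc.of_cons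
    have hhead : ∀ r ∈ l.head?, s.1 ≠ r.1 := (List.isChain_cons.mp hc).1
    obtain ⟨t, p⟩ := s
    obtain ⟨hp, hp0⟩ := hl _ List.mem_cons_self
    rw [List.map_cons, List.prod_cons, map_mul, Module.End.mul_apply]
    fin_cases t
    · obtain ⟨a, rfl⟩ := hp
      have ha : μI a = 0 := (freeProduct_rename_inl hμI a).symm.trans hp0
      have hw := ih0 fun r hr => (hhead r hr).symm
      have haug : aug B I (encode μI a) = 0 := by rw [aug_encode, ha]
      change (_ → freeRep μI μJ (rename Sum.inl a) _ ∈ _) ∧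
        (_ → freeRep μI μJ (rename Sum.inl a) _ ∈ _) ∧
        (_ → aug B _ (freeRep μI μJ (rename Sum.inl a) _) = 0)
      rw [freeRep_rename_inl hμI, act_rename_mul hμI hw]
      refine ⟨fun h => absurd rfl (h _ rfl), fun _ => ?_, fun _ => ?_⟩
      · have := rename_sub_aug_mul_mem_inert (d := Sum.getRight?) hμJ isPartialInv_inr
          (g := (Sum.inl : I → I ⊕ J)) (fun _ => rfl) (encode μI a)
        rw [haug, map_zero, sub_zero] at this
        exact this _
      · rw [map_mul, aug_rename, haug, zero_mul]
    · obtain ⟨a, rfl⟩ := hp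
      have ha : μJ a = 0 := (freeProduct_rename_inr hμJ a).symm.trans hp0
      have hw := ih1 fun r hr => (hhead r hr).symm
      have haug : aug B J (encode μJ a) = 0 := by rw [aug_encode, ha]
      change (_ → freeRep μI μJ (rename Sum.inr a) _ ∈ _) ∧
        (_ → freeRep μI μJ (rename Sum.inr a) _ ∈ _) ∧
        (_ → aug B _ (freeRep μI μJ (rename Sum.inr a) _) = 0)
      rw [freeRep_rename_inr hμJ, act_rename_mul hμJ hw]
      refine ⟨fun _ => ?_, fun h => absurd rfl (h _ rfl), fun _ => ?_⟩
      · have := rename_sub_aug_mul_mem_inert (d := Sum.getLeft?) hμI isPartialInv_inl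
          (g := (Sum.inr : J → I ⊕ J)) (fun _ => rfl) (encode μJ a)
        rw [haug, map_zero, sub_zero] at this
        exact this _
      · rw [map_mul, aug_rename, haug, zero_mul]

theorem freeProduct_isFreeOver (hμI : IsJointDistribution μI) (hμJ : IsJointDistribution μJ) :
    IsFreeOver (freeProduct μI μJ) ![(rename (B := B) (Sum.inl : I → I ⊕ J)).range,
      (rename (B := B) (Sum.inr : J → I ⊕ J)).range] :=
  fun l hl0 hl hc => (freeRep_alternating hμI hμJ l hl hc).2.2 hl0

theorem star_rename {K : Type*} (f : I → K) (a : NCPoly B I) :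
    star (rename f a) = rename f (star a) := by
  induction a using NCPoly.induction with
  | hC b => simp
  | hX i => simp
  | hadd p q hp hq => rw [map_add, star_add, star_add, map_add, hp, hq]
  | hmul p q hp hq => rw [map_mul, star_mul, star_mul, map_mul, hp, hq]

theorem gram_mem_posKernel_of_mem_range {K : Type*} {f : I → K} {ν : NCPoly B K →ₗ[ℂ] B}
    (hμI : IsJointDistribution μI) (hν : ∀ a, ν (rename f a) = μI a) {ι : Type} [Finite ι]
    {a : ι → NCPoly B K} (ha : ∀ i, a i ∈ (rename (B := B) f).range) :
    gram ν a ∈ posKernel ι B := by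
  choose a' ha' using ha
  convert hμI.gram_mem_posKernel a' using 1
  ext i j
  simp only [gram, Matrix.of_apply, ← hν, map_mul, ← star_rename]
  rw [← ha' i, ← ha' j]
  rfl

theorem freeProduct_isFreePair (hμI : IsJointDistribution μI) (hμJ : IsJointDistribution μJ) :
    IsFreePair (freeProduct μI μJ) ![(rename (B := B) (Sum.inl : I → I ⊕ J)).range,
      (rename (B := B) (Sum.inr : J → I ⊕ J)).range] where
  map_one := freeProduct_one
  map_bimodule := freeProduct_bimodule hμI hμJ
  C_mem t b := by
    fin_cases t
    · exact ⟨C I b, rename_C _ b⟩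
    · exact ⟨C J b, rename_C _ b⟩
  star_mem t a ha := by
    fin_cases t
    · obtain ⟨a, rfl⟩ := ha; exact ⟨star a, (star_rename _ a).symm⟩
    · obtain ⟨a, rfl⟩ := ha; exact ⟨star a, (star_rename _ a).symm⟩
  X_mem k := by
    cases k with
    | inl i => exact ⟨0, X B i, rename_X _ i⟩
    | inr j => exact ⟨1, X B j, rename_X _ j⟩
  gram_mem t ι _ a ha := by
    fin_cases t
    · exact gram_mem_posKernel_of_mem_range hμI (freeProduct_rename_inl hμI) ha
    · exact gram_mem_posKernel_of_mem_range hμJ (freeProduct_rename_inr hμJ) ha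
  free := freeProduct_isFreeOver hμI hμJ

theorem PolyBound.freeRep_X {R : ℝ} (hR : 0 ≤ R) (hμI : IsJointDistribution μI)
    (hμJ : IsJointDistribution μJ)
    (hI : ∀ p r, MonomialBound R p r → ‖μI p‖ ≤ r)
    (hJ : ∀ p r, MonomialBound R p r → ‖μJ p‖ ≤ r) (k : I ⊕ J) {p : NCPoly B (I ⊕ J)} {r : ℝ}
    (h : PolyBound R p r) : PolyBound R (freeRep μI μJ (X B k) p) (9 * R * r) := by
  cases k with
  | inl i =>
    rw [← rename_X Sum.inl, freeRep_rename_inl hμI]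
    exact h.act_X hR hI isPartialInv_inl i
  | inr j =>
    rw [← rename_X Sum.inr, freeRep_rename_inr hμJ]
    exact h.act_X hR hJ isPartialInv_inr j

end FreeProduct

end NCPoly

open NCPoly

namespace IsJointDistribution

variable {B : Type u} [CStarAlgebra B] {I : Type v} {J : Type w}
  {μI : NCPoly B I →ₗ[ℂ] B} {μJ : NCPoly B J →ₗ[ℂ] B}

/-- Stated for every larger radius, so that both factors can use a common one. -/
theorem exists_forall_monomialBound (hμI : IsJointDistribution μI) :
    ∃ M : ℝ, 0 < M ∧ ∀ R, M ≤ R → ∀ p r, MonomialBound R p r → ‖μI p‖ ≤ r := by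
  obtain ⟨M, hM, hb⟩ := hμI.exponentiallyBounded
  refine ⟨M, hM, fun R hMR p r h => h.norm_map_le (hM.le.trans hMR) hμI (fun i l => ?_)⟩
  refine (hb i l).trans ?_
  have : 0 ≤ (l.map fun s => ‖s.1‖).prod := List.prod_nonneg (by
    rintro _ ha
    obtain ⟨s, -, rfl⟩ := List.mem_map.mp ha
    exact norm_nonneg _)
  gcongr

theorem freeProduct_exponentiallyBounded (hμI : IsJointDistribution μI)
    (hμJ : IsJointDistribution μJ) :
    ∃ M : ℝ, 0 < M ∧ ∀ (k : I ⊕ J) (l : List (B × (I ⊕ J))),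
      ‖freeProduct μI μJ (X B k * (l.map fun s => C (I ⊕ J) s.1 * X B s.2).prod)‖
        ≤ M ^ (l.length + 1) * (l.map fun s => ‖s.1‖).prod := by
  obtain ⟨M, hM, hI⟩ := hμI.exists_forall_monomialBound
  obtain ⟨N, _, hJ⟩ := hμJ.exists_forall_monomialBound
  set R := max M N
  have hR : 0 < R := lt_max_of_lt_left hM
  have hX : ∀ (k : I ⊕ J) {p r}, PolyBound R p r →
      PolyBound R (freeRep μI μJ (X B k) p) (9 * R * r) := fun k _ _ h =>
    h.freeRep_X hR.le hμI hμJ (hI R (le_max_left _ _)) (hJ R (le_max_right _ _)) k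
  have hl : ∀ l : List (B × (I ⊕ J)),
      PolyBound R (freeRep μI μJ (l.map fun s => C (I ⊕ J) s.1 * X B s.2).prod 1)
        ((9 * R) ^ l.length * (l.map fun s => ‖s.1‖).prod) := by
    intro l
    induction l with
    | nil =>
      simpa using PolyBound.of (MonomialBound.one R)
    | cons s l ih =>
      rw [List.map_cons, List.prod_cons, map_mul, map_mul, Module.End.mul_apply,
        Module.End.mul_apply, freeRep_C]
      refine (PolyBound.mul hR.le (.of (.const s.1 _ le_rfl)) (hX s.2 ih)).mono (le_of_eq ?_)
      simp only [List.length_cons, List.map_cons, List.prod_cons]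
      ring
  -- Each variable contributes 9R and each coefficient its norm, starting from the vector 1 of
  -- weight 1.
  refine ⟨9 * R, by positivity, fun k l => ?_⟩
  rw [freeProduct_apply, map_mul, Module.End.mul_apply, pow_succ', mul_assoc]
  exact PolyBound.norm_map_le (φ := (aug B (I ⊕ J)).toLinearMap)
    (fun p r h => h.norm_aug_le hR.le) (hX k (hl l))

theorem freeProduct (hμI : IsJointDistribution μI) (hμJ : IsJointDistribution μJ) :
    IsJointDistribution (NCPoly.freeProduct μI μJ) where
  map_one := freeProduct_one
  map_bimodule := freeProduct_bimodule hμI hμJ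
  completelyPositive := (freeProduct_isFreePair hμI hμJ).completelyPositive
  exponentiallyBounded := freeProduct_exponentiallyBounded hμI hμJ

end IsJointDistribution

end

theorem theorem5p14 {B : Type u} [CStarAlgebra B] {I : Type v} {J : Type w}
    (μI : NCPoly B I →ₗ[ℂ] B) (hμI : IsJointDistribution μI)
    (μJ : NCPoly B J →ₗ[ℂ] B) (hμJ : IsJointDistribution μJ) :
    ∃! μ : NCPoly B (I ⊕ J) →ₗ[ℂ] B,
      IsJointDistribution μ ∧
      (∀ p : NCPoly B I, μ (NCPoly.rename Sum.inl p) = μI p) ∧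
      (∀ q : NCPoly B J, μ (NCPoly.rename Sum.inr q) = μJ q) ∧
      IsFreeOver μ ![(NCPoly.rename (B := B) (Sum.inl : I → I ⊕ J)).range,
        (NCPoly.rename (B := B) (Sum.inr : J → I ⊕ J)).range] := by
  refine ⟨NCPoly.freeProduct μI μJ, ⟨hμI.freeProduct hμJ, NCPoly.freeProduct_rename_inl hμI,
    NCPoly.freeProduct_rename_inr hμJ, NCPoly.freeProduct_isFreeOver hμI hμJ⟩, ?_⟩
  rintro ν ⟨hν, hνI, hνJ, hfree⟩
  refine (NCPoly.freeProduct_isFreePair hμI hμJ).eq_of_free (fun t a ha => ?_) hν.map_mul_C hfree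
  fin_cases t
  · obtain ⟨a, rfl⟩ := ha
    exact (hνI a).trans (NCPoly.freeProduct_rename_inl hμI a).symm
  · obtain ⟨a, rfl⟩ := ha
    exact (hνJ a).trans (NCPoly.freeProduct_rename_inr hμJ a).symm
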